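/- Let $N,T,d\ge 1$ and $k\ge 0$ be integers with $k<T$. For $d\times d$ real matrices $B_0,\dots,B_k$ such that $B_0$ is acyclic (the directed graph on $\{1,\dots,d\}$ with an edge $i\to j$ whenever $(B_0)_{ij}\neq 0$ has no directed cycle) and for $\beta>0$, a random tensor $X\in\mathbb{R}^{N\times T\times d}$ is said to follow the Laplacian SVAR with parameters $(B_0,\dots,B_k,\beta)$ if there are i.i.d. structural shocks $S_{n,t,j}\sim\mathrm{Laplace}(0,\beta)$, i.e. with density $s\mapsto \frac{1}{2\beta}e^{-|s|/\beta}$, such that $X=X_{\mathrm{past}}W+S$ almost surely, that is, for every realization $n\in\{1,\dots,N\}$ and every time $t\in\{0,\dots,T-1\}$, $$x_{n,t}=x_{n,t}B_0+x_{n,t-1}B_1+\dots+x_{n,t-k}B_k+s_{n,t},$$ where $x_{n,t},s_{n,t}\in\mathbb{R}^{1\times d}$ are the rows of $X$ and $S$, $x_{n,t}=0$ for $t<0$, and $W$ is the matrix with block rows $B_0,\dots,B_k$. **Theorem 1.** The matrices $B_0,\dots,B_k$ and $\beta$ are identifiable from the distribution of the data: let $X^*$ follow the Laplacian SVAR with ground-truth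 parameters $(B_0^*,\dots,B_k^*,\beta^*)$, where $B_0^*$ is acyclic and $\beta^*>\frac{1}{NTd}$, and let $X$ follow the Laplacian SVAR with parameters $(B_0,\dots,B_k,\beta)$, where $B_0$ is acyclic and $\beta>0$. If $X$ and $X^*$ have the same distribution, then $B_\tau=B_\tau^*$ for all $\tau=0,\dots,k$, and $\beta=\beta^*$. -/

import Mathlib

open MeasureTheory ProbabilityTheory

noncomputable section

/-- Density of the Laplace distribution with location `m` and scale `b`. -/
def laplacePDFReal (m b x : ℝ) : ℝ :=
  1 / (2 * b) * Real.exp (-(|x - m| / b))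

/-- The law `Laplace(m, b)` on the real line (meaningful for `0 < b`). -/
def laplaceMeasure (m b : ℝ) : Measure ℝ :=
  volume.withDensity fun x => ENNReal.ofReal (laplacePDFReal m b x)

/-- The weighted digraph on `Fin d` with an edge `i → j` of weight `A i j` whenever `A i j ≠ 0`
has no directed cycle (self-loops included). -/
def IsAcyclicAdj {d : ℕ} (A : Matrix (Fin d) (Fin d) ℝ) : Prop :=
  ∀ i : Fin d, ¬ Relation.TransGen (fun a b => A a b ≠ 0) i i

/-- The window graph `W`: the matrices `B 0, …, B k` stacked as block rows. -/
def windowGraph {d k : ℕ} (B : Fin (k + 1) → Matrix (Fin d) (Fin d) ℝ) :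
    Matrix (Fin (k + 1) × Fin d) (Fin d) ℝ :=
  Matrix.of fun p j => B p.1 p.2 j

/-- The matrix `X_past`: its row `t` is `(x_t, x_{t-1}, …, x_{t-k})`, where `x_s = 0` for `s < 0`. -/
def pastMatrix {T d : ℕ} (k : ℕ) (X : Fin T → Fin d → ℝ) :
    Matrix (Fin T) (Fin (k + 1) × Fin d) ℝ :=
  Matrix.of fun t p =>
    if (p.1 : ℕ) ≤ (t : ℕ) then
      X ⟨(t : ℕ) - (p.1 : ℕ), lt_of_le_of_lt (Nat.sub_le _ _) t.isLt⟩ p.2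
    else 0

/-- The random tensor `X` (`N` realizations of a `d`-dimensional time series of length `T`) follows
the SVAR `X = X_past W + S` with window graph `B 0, …, B k`, where the entries of the random
tensor `S` of structural shocks are independent and `Laplace(0, b)` distributed. -/
structure IsLaplaceSVAR {N T d k : ℕ} {Ω : Type*} [MeasurableSpace Ω] (μ : Measure Ω)
    (B : Fin (k + 1) → Matrix (Fin d) (Fin d) ℝ) (b : ℝ)
    (X S : Ω → Fin N → Fin T → Fin d → ℝ) : Prop where
  shock_law : ∀ n t j, HasLaw (fun ω => S ω n t j) (laplaceMeasure 0 b) μ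
  shock_indep :
    iIndepFun (fun (p : Fin N × Fin T × Fin d) (ω : Ω) => S ω p.1 p.2.1 p.2.2) μ
  equation : ∀ᵐ ω ∂μ, ∀ n,
    Matrix.of (X ω n) = pastMatrix k (X ω n) * windowGraph B + Matrix.of (S ω n)

end

/-!
Identifiability of the Laplacian SVAR from the law of a single realization.

Flattening time and variable into one index set `Fin T × Fin d`, a realization `x` satisfies
`x ᵥ* M = s` with `M = 1 - A`, where `A` is the weighted adjacency matrix of the graph unrolled in
time (`unrolledAdj`). That graph is acyclic: ordered lexicographically by time and then by
the order of `B 0`, its edge relation is well-founded (`wellFounded_unrolledAdj`), so `M` is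
invertible with ones on its diagonal.

The shocks have a density proportional to `exp (-‖s‖₁ / β)`. If two parameter sets give the same law
of `x`, then the invertible matrix `K = M'⁻¹ * M` maps one Laplace law to the other. Comparing the
two continuous densities yields `‖y ᵥ* K‖₁ / β = ‖y‖₁ / β'` for all `y`
(`sum_abs_vecMul_eq_of_map_laplace`). A multiple of an `ℓ¹`-isometry is a generalized permutation
matrix: its rows have disjoint supports (`mul_eq_zero_of_sum_abs_vecMul`), and by counting each
support is a single column. Finally `M = M' * K` together with the acyclicity of `A` and the unit
diagonals forces the permutation to be trivial and `K = 1` (`eq_one_of_one_sub_eq_mul`); so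
`M = M'`, and then `β = β'`.
-/

/-! ### Densities of products of Laplace laws -/

lemma laplacePDFReal_nonneg {b : ℝ} (hb : 0 < b) (m x : ℝ) : 0 ≤ laplacePDFReal m b x := by
  unfold laplacePDFReal; positivity

lemma continuous_laplacePDFReal (m b : ℝ) : Continuous (laplacePDFReal m b) := by
  unfold laplacePDFReal; fun_prop

lemma pi_withDensity_ofReal {ι : Type*} [Fintype ι] {f : ℝ → ℝ} (hf : Integrable f)
    (h0 : ∀ x, 0 ≤ f x) :
    Measure.pi (fun _ : ι => (volume : Measure ℝ).withDensity fun x => ENNReal.ofReal (f x)) =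
      (volume : Measure (ι → ℝ)).withDensity fun x => ENNReal.ofReal (∏ i, f (x i)) := by
  have : IsFiniteMeasure ((volume : Measure ℝ).withDensity fun x => ENNReal.ofReal (f x)) :=
    isFiniteMeasure_withDensity_ofReal hf.2
  refine Measure.pi_eq fun s hs => ?_
  rw [withDensity_apply _ (MeasurableSet.univ_pi hs), volume_pi, Measure.restrict_pi_pi,
    ← ofReal_integral_eq_lintegral_ofReal
      (Integrable.fintype_prod (f := fun _ => f) fun i => hf.mono_measure Measure.restrict_le_self)
      (Filter.Eventually.of_forall fun x => Finset.prod_nonneg fun i _ => h0 _),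
    integral_fintype_prod_eq_prod (fun _ => f),
    ENNReal.ofReal_prod_of_nonneg fun i _ => integral_nonneg fun x => h0 x]
  refine Finset.prod_congr rfl fun i _ => ?_
  rw [withDensity_apply _ (hs i),
    ofReal_integral_eq_lintegral_ofReal hf.restrict (Filter.Eventually.of_forall h0)]

lemma prod_laplacePDFReal {ι : Type*} [Fintype ι] (b : ℝ) (x : ι → ℝ) :
    ∏ i, laplacePDFReal 0 b (x i) =
      (1 / (2 * b)) ^ Fintype.card ι * Real.exp (-((∑ i, |x i|) / b)) := by
  simp [laplacePDFReal, Finset.prod_mul_distrib, ← Real.exp_sum, Finset.sum_div]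

lemma integrable_laplacePDFReal {m b : ℝ} (hb : 0 < b) [IsFiniteMeasure (laplaceMeasure m b)] :
    Integrable (laplacePDFReal m b) := by
  rw [← lintegral_ofReal_ne_top_iff_integrable
    (continuous_laplacePDFReal m b).aestronglyMeasurable
    (Filter.Eventually.of_forall (laplacePDFReal_nonneg hb m))]
  have := measure_ne_top (laplaceMeasure m b) Set.univ
  rwa [laplaceMeasure, withDensity_apply _ MeasurableSet.univ, Measure.restrict_univ] at this

/-- Pushing a product of Laplace laws forward by an invertible matrix can only give a product of
Laplace laws if the inverse matrix is a multiple of an `ℓ¹`-isometry: the two continuous densities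
agree everywhere, and their values at the origin fix the normalizing constants. -/
lemma sum_abs_vecMul_eq_of_map_laplace {ι : Type*} [Fintype ι] [DecidableEq ι] {b b' : ℝ}
    (hb : 0 < b) (hb' : 0 < b') [IsFiniteMeasure (laplaceMeasure 0 b)]
    [IsFiniteMeasure (laplaceMeasure 0 b')] {L K : Matrix ι ι ℝ} (hLK : L * K = 1)
    (h : (Measure.pi fun _ : ι => laplaceMeasure 0 b).map (fun x => Matrix.vecMul x L) =
      Measure.pi fun _ : ι => laplaceMeasure 0 b') (y : ι → ℝ) :
    (∑ i, |Matrix.vecMul y K i|) / b = (∑ i, |y i|) / b' := by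
  have hKL : K * L = 1 := mul_eq_one_comm.mp hLK
  have hdet : L.transpose.det ≠ 0 := by
    rw [Matrix.det_transpose]
    intro h0
    have := congrArg Matrix.det hLK
    simp [h0] at this
  have hvol := Real.map_matrix_volume_pi_eq_smul_volume_pi hdet
  set c : ℝ := |(L.transpose.det)⁻¹| with hc
  have hcpos : 0 < c := by positivity
  have hLfun : ⇑(Matrix.toLin' L.transpose) = fun x => Matrix.vecMul x L := by
    ext x; simp [Matrix.mulVec_transpose]
  rw [hLfun] at hvol
  have hmL : Measurable fun x : ι → ℝ => Matrix.vecMul x L :=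
    (continuous_id.matrix_vecMul continuous_const).measurable
  set g : (ι → ℝ) → ℝ := fun x => ∏ i, laplacePDFReal 0 b (x i) with hg
  set g' : (ι → ℝ) → ℝ := fun x => ∏ i, laplacePDFReal 0 b' (x i) with hg'
  have hgc : Continuous g := continuous_finsetProd _ fun i _ =>
    (continuous_laplacePDFReal 0 b).comp (continuous_apply i)
  have hgc' : Continuous g' := continuous_finsetProd _ fun i _ =>
    (continuous_laplacePDFReal 0 b').comp (continuous_apply i)
  have hKc : Continuous fun x : ι → ℝ => Matrix.vecMul x K :=
    continuous_id.matrix_vecMul continuous_const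
  have hgK : Continuous fun x => g (Matrix.vecMul x K) := hgc.comp hKc
  have e1 : Measure.pi (fun _ : ι => laplaceMeasure 0 b) =
      volume.withDensity fun x => ENNReal.ofReal (g x) :=
    pi_withDensity_ofReal (integrable_laplacePDFReal hb) (laplacePDFReal_nonneg hb 0)
  have e2 : Measure.pi (fun _ : ι => laplaceMeasure 0 b') =
      volume.withDensity fun x => ENNReal.ofReal (g' x) :=
    pi_withDensity_ofReal (integrable_laplacePDFReal hb') (laplacePDFReal_nonneg hb' 0)
  have e3 : (volume.withDensity fun x : ι → ℝ => ENNReal.ofReal (g x)).map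
      (fun x => Matrix.vecMul x L) =
      volume.withDensity fun x => ENNReal.ofReal (c * g (Matrix.vecMul x K)) := by
    ext s hs
    rw [Measure.map_apply hmL hs, withDensity_apply _ (hmL hs), withDensity_apply _ hs]
    have : (fun x : ι → ℝ => ENNReal.ofReal (g x)) =
        fun x => ENNReal.ofReal (g (Matrix.vecMul (Matrix.vecMul x L) K)) := by
      funext x; simp [Matrix.vecMul_vecMul, hLK]
    rw [this, ← setLIntegral_map (f := fun z => ENNReal.ofReal (g (Matrix.vecMul z K))) hs
      (hgK.measurable.ennreal_ofReal) hmL, hvol, Measure.restrict_smul, lintegral_smul_measure]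
    simp only [ENNReal.ofReal_mul hcpos.le]
    rw [lintegral_const_mul _ hgK.measurable.ennreal_ofReal, smul_eq_mul]
  rw [e1, e2, e3, withDensity_eq_iff_of_sigmaFinite
    (hgK.const_mul c |>.measurable.ennreal_ofReal.aemeasurable)
    hgc'.measurable.ennreal_ofReal.aemeasurable] at h
  have h' := ((ENNReal.continuous_ofReal.comp (hgK.const_mul c)).ae_eq_iff_eq volume
    (ENNReal.continuous_ofReal.comp hgc')).mp h
  have key : ∀ x : ι → ℝ, c * g (Matrix.vecMul x K) = g' x := fun x =>
    (ENNReal.ofReal_eq_ofReal_iff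
      (mul_nonneg hcpos.le (Finset.prod_nonneg fun i _ => laplacePDFReal_nonneg hb _ _))
      (Finset.prod_nonneg fun i _ => laplacePDFReal_nonneg hb' _ _)).mp (congrFun h' x)
  simp only [hg, hg', prod_laplacePDFReal] at key
  have h0 : c * (1 / (2 * b)) ^ Fintype.card ι = (1 / (2 * b')) ^ Fintype.card ι := by
    simpa using key 0
  have hy := key y
  rw [← mul_assoc, h0] at hy
  have := mul_left_cancel₀ (by positivity) hy
  simpa using Real.exp_injective this

/-! ### Multiples of `ℓ¹`-isometries -/

/-- The rows of a multiple of an `ℓ¹`-isometry have disjoint supports, because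
`‖e p + e q‖₁ + ‖e p - e q‖₁ = 2 (‖e p‖₁ + ‖e q‖₁)` while
`|u + v| + |u - v| ≤ 2 (|u| + |v|)` is strict unless `u * v = 0`. -/
lemma mul_eq_zero_of_sum_abs_vecMul {ι : Type*} [Fintype ι] [DecidableEq ι] {K : Matrix ι ι ℝ}
    {r : ℝ} (h : ∀ y : ι → ℝ, ∑ i, |Matrix.vecMul y K i| = r * ∑ i, |y i|) {p q : ι}
    (hpq : p ≠ q) (j : ι) : K p j * K q j = 0 := by
  have hrow : ∀ p, ∑ j, |K p j| = r := fun p => by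
    simpa [Pi.single_apply, apply_ite abs] using h (Pi.single p 1)
  have hsum : ∑ j, |Matrix.vecMul (Pi.single p (1 : ℝ) + Pi.single q 1) K j| = r * 2 := by
    rw [h]
    congr 1
    calc ∑ i, |(Pi.single p (1 : ℝ) + Pi.single q (1 : ℝ) : ι → ℝ) i|
        = ∑ i, ((Pi.single p (1 : ℝ) : ι → ℝ) i + (Pi.single q (1 : ℝ) : ι → ℝ) i) := by
          refine Finset.sum_congr rfl fun i _ => abs_of_nonneg ?_
          simp only [Pi.add_apply, Pi.single_apply]; split_ifs <;> norm_num
      _ = 2 := by rw [Finset.sum_add_distrib]; simp; norm_num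
  have hdiff : ∑ j, |Matrix.vecMul (Pi.single p (1 : ℝ) - Pi.single q 1) K j| = r * 2 := by
    rw [h]
    congr 1
    calc ∑ i, |(Pi.single p (1 : ℝ) - Pi.single q (1 : ℝ) : ι → ℝ) i|
        = ∑ i, ((Pi.single p (1 : ℝ) : ι → ℝ) i + (Pi.single q (1 : ℝ) : ι → ℝ) i) := by
          refine Finset.sum_congr rfl fun i _ => ?_
          simp only [Pi.sub_apply, Pi.single_apply]
          split_ifs with h1 h2
          · exact absurd (h1.symm.trans h2) hpq
          all_goals norm_num
      _ = 2 := by rw [Finset.sum_add_distrib]; simp; norm_num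
  simp only [Matrix.add_vecMul, Matrix.sub_vecMul, Matrix.single_one_vecMul, Pi.add_apply,
    Pi.sub_apply, Matrix.row_apply] at hsum hdiff
  have hz : ∑ j, (2 * (|K p j| + |K q j|) - |K p j + K q j| - |K p j - K q j|) = 0 := by
    simp only [Finset.sum_sub_distrib, ← Finset.mul_sum, Finset.sum_add_distrib, hrow, hsum, hdiff]
    ring
  have hj := (Finset.sum_eq_zero_iff_of_nonneg fun j _ => by
    linarith [abs_add_le (K p j) (K q j), abs_sub (K p j) (K q j)]).mp hz j (Finset.mem_univ j)
  have hadd := abs_add_le (K p j) (K q j)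
  have hsub := abs_sub (K p j) (K q j)
  have h1 : |K p j + K q j| = |K p j| + |K q j| := by linarith
  have h2 : |K p j - K q j| = |K p j| + |K q j| := by linarith
  have := h1.trans h2.symm
  have := sq_eq_sq_iff_abs_eq_abs _ _ |>.mpr this
  linarith

/-- A multiple of an `ℓ¹`-isometry has exactly one nonzero entry in each row and each column. -/
lemma exists_perm_support_of_sum_abs_vecMul {ι : Type*} [Fintype ι] [DecidableEq ι]
    {K : Matrix ι ι ℝ} {r : ℝ} (hr : 0 < r)
    (h : ∀ y : ι → ℝ, ∑ i, |Matrix.vecMul y K i| = r * ∑ i, |y i|) :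
    ∃ σ : Equiv.Perm ι, ∀ p j, K p j ≠ 0 ↔ j = σ p := by
  have hex : ∀ p, ∃ j, K p j ≠ 0 := fun p => by
    by_contra! h0
    have : 0 = r := by simpa [Pi.single_apply, apply_ite abs, h0] using h (Pi.single p 1)
    exact hr.ne this
  choose σ hσ using hex
  have huniq : ∀ {p q j}, K p j ≠ 0 → K q j ≠ 0 → p = q := fun {p q j} hp hq => by
    by_contra hne
    exact mul_ne_zero hp hq (mul_eq_zero_of_sum_abs_vecMul h hne j)
  have hinj : Function.Injective σ := fun p q hpq => huniq (hσ p) (hpq ▸ hσ q)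
  refine ⟨Equiv.ofBijective σ (Finite.injective_iff_bijective.mp hinj), fun p j => ⟨fun hj => ?_,
    fun hj => hj ▸ hσ p⟩⟩
  obtain ⟨q, rfl⟩ := Finite.surjective_of_injective hinj j
  rw [huniq hj (hσ q)]
  rfl

/-! ### Acyclic weight matrices -/

/-- If the edges of `A` are well-founded, `1 - A` is invertible. -/
lemma isUnit_one_sub_of_wellFounded {ι : Type*} [Fintype ι] [DecidableEq ι] {A : Matrix ι ι ℝ}
    (hA : WellFounded fun p q => A p q ≠ 0) : IsUnit (1 - A) := by
  rw [Matrix.isUnit_iff_isUnit_det, isUnit_iff_ne_zero]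
  intro hdet
  obtain ⟨v, hv, hv0⟩ := Matrix.exists_vecMul_eq_zero_iff.mpr hdet
  refine hv (funext fun p => ?_)
  induction p using hA.induction with
  | _ p ih =>
    have hp : v p = Matrix.vecMul v A p := by
      have := congrFun hv0 p
      simp only [Matrix.vecMul_sub, Matrix.vecMul_one, Pi.sub_apply, Pi.zero_apply] at this
      linarith
    rw [hp]
    refine Finset.sum_eq_zero fun q _ => ?_
    by_cases hq : A q p = 0
    · exact mul_eq_zero_of_right _ hq
    · exact mul_eq_zero_of_left (ih q hq) _

/-- Two unit-diagonal matrices `1 - A = M' * K` that differ by a multiple `K` of an `ℓ¹`-isometry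
coincide when `A` is acyclic: column `σ p` of `1 - A` is a nonzero multiple of column `p` of `M'`, so
its entry in row `p` does not vanish. Hence `p → σ p` is an edge of `A` whenever `σ p ≠ p`,
and a nontrivial permutation would close up to a cycle. -/
lemma eq_one_of_one_sub_eq_mul {ι : Type*} [Fintype ι] [DecidableEq ι] {A M' K : Matrix ι ι ℝ}
    {r : ℝ} (hr : 0 < r) (hA : WellFounded fun p q => A p q ≠ 0) (hM' : ∀ p, M' p p = 1)
    (hK : ∀ y : ι → ℝ, ∑ i, |Matrix.vecMul y K i| = r * ∑ i, |y i|) (h : 1 - A = M' * K) :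
    K = 1 := by
  obtain ⟨σ, hσ⟩ := exists_perm_support_of_sum_abs_vecMul hr hK
  have hcol : ∀ p q, (1 - A) q (σ p) = M' q p * K p (σ p) := fun p q => by
    rw [h, Matrix.mul_apply]
    refine Finset.sum_eq_single p (fun s _ hs => ?_) (by simp)
    have : K s (σ p) = 0 := by
      by_contra hne
      exact hs (σ.injective ((hσ _ _).mp hne)).symm
    rw [this, mul_zero]
  have hedge : ∀ p, σ p ≠ p → A p (σ p) ≠ 0 := fun p hp h0 => by
    have := hcol p p
    rw [hM', one_mul, Matrix.sub_apply, Matrix.one_apply_ne hp.symm, h0, sub_zero] at this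
    exact (hσ p (σ p)).mpr rfl this.symm
  have hid : ∀ p, σ p = p := fun p => by
    induction p using hA.induction with
    | _ p ih =>
      by_contra hp
      -- The edge into `p` comes from its preimage under `σ`, which is fixed by induction.
      have hp' : σ (σ.symm p) ≠ σ.symm p := fun hq => hp (by
        rw [Equiv.apply_symm_apply] at hq
        exact (congrArg σ hq).trans (σ.apply_symm_apply p))
      have he := hedge _ hp'
      rw [Equiv.apply_symm_apply] at he
      exact hp' (ih _ he)
  have hAdiag : ∀ p, A p p = 0 := fun p => by
    by_contra hp
    exact hA.irrefl.irrefl p hp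
  ext p j
  by_cases hpj : p = j
  · subst hpj
    have := hcol p p
    rw [hid, hM', one_mul, Matrix.sub_apply, hAdiag, sub_zero] at this
    exact this.symm
  · rw [Matrix.one_apply_ne hpj]
    by_contra hne
    exact hpj ((((hσ p j).mp hne).trans (hid p)).symm)

/-! ### The SVAR unrolled in time -/

/-- The weighted adjacency matrix of the SVAR unrolled in time: `(s, i)` acts on `(t, j)` with weight
`B (t - s) i j` if `s ≤ t ≤ s + k`, and with weight `0` otherwise. -/
def unrolledAdj {d k : ℕ} (T : ℕ) (B : Fin (k + 1) → Matrix (Fin d) (Fin d) ℝ) :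
    Matrix (Fin T × Fin d) (Fin T × Fin d) ℝ :=
  Matrix.of fun p q => ∑ τ : Fin (k + 1), if (p.1 : ℕ) + τ = q.1 then B τ p.2 q.2 else 0

lemma wellFounded_of_isAcyclicAdj {d : ℕ} {A : Matrix (Fin d) (Fin d) ℝ} (hA : IsAcyclicAdj A) :
    WellFounded fun i j => A i j ≠ 0 := by
  have : Std.Irrefl (Relation.TransGen fun i j => A i j ≠ 0) := ⟨hA⟩
  exact Subrelation.wf (r := Relation.TransGen fun i j => A i j ≠ 0)
    (fun h => Relation.TransGen.single h)
    (Finite.wellFounded_of_trans_of_irrefl _)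

lemma wellFounded_unrolledAdj {T d k : ℕ} {B : Fin (k + 1) → Matrix (Fin d) (Fin d) ℝ}
    (hB : IsAcyclicAdj (B 0)) : WellFounded fun p q => unrolledAdj T B p q ≠ 0 := by
  refine Subrelation.wf ?_
    ((wellFounded_lt (α := Fin T)).prod_lex (wellFounded_of_isAcyclicAdj hB))
  intro p q hpq
  simp only [unrolledAdj, Matrix.of_apply] at hpq
  obtain ⟨τ, -, hτ⟩ := Finset.exists_ne_zero_of_sum_ne_zero hpq
  split_ifs at hτ with h
  · rw [Prod.lex_def]
    rcases Nat.eq_zero_or_pos (τ : ℕ) with h0 | h0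
    · have : τ = 0 := Fin.ext h0
      subst this
      exact Or.inr ⟨Fin.ext h, hτ⟩
    · exact Or.inl (Fin.lt_def.mpr (by omega))
  · exact absurd rfl hτ

lemma unrolledAdj_apply_self {T d k : ℕ} {B : Fin (k + 1) → Matrix (Fin d) (Fin d) ℝ}
    (hB : IsAcyclicAdj (B 0)) (p : Fin T × Fin d) : unrolledAdj T B p p = 0 := by
  by_contra hp
  exact (wellFounded_unrolledAdj hB).irrefl.irrefl p hp

/-- Since `k < T`, every lag is seen from time `0`. -/
lemma unrolledAdj_zero_left {T d k : ℕ} (B : Fin (k + 1) → Matrix (Fin d) (Fin d) ℝ) (hkT : k < T)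
    (τ : Fin (k + 1)) (i j : Fin d) :
    unrolledAdj T B (⟨0, by omega⟩, i) (⟨τ, by omega⟩, j) = B τ i j := by
  simp [unrolledAdj, Fin.val_inj]

lemma pastMatrix_mul_windowGraph_apply {T d k : ℕ} (B : Fin (k + 1) → Matrix (Fin d) (Fin d) ℝ)
    (x : Fin T → Fin d → ℝ) (t : Fin T) (j : Fin d) :
    (pastMatrix k x * windowGraph B) t j =
      Matrix.vecMul (fun p : Fin T × Fin d => x p.1 p.2) (unrolledAdj T B) (t, j) := by
  have hlag : ∀ (τ : Fin (k + 1)) (i : Fin d),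
      pastMatrix k x t (τ, i) = ∑ s : Fin T, if (s : ℕ) + τ = t then x s i else 0 := by
    intro τ i
    simp only [pastMatrix, Matrix.of_apply]
    split_ifs with h
    · rw [Finset.sum_eq_single ⟨(t : ℕ) - τ, by omega⟩]
      · rw [if_pos (by simp; omega)]
      · intro s _ hs
        exact if_neg fun h' => hs (Fin.ext (by simp; omega))
      · simp
    · exact (Finset.sum_eq_zero fun s _ => if_neg (by omega)).symm
  simp only [Matrix.mul_apply, Fintype.sum_prod_type, hlag, windowGraph, Matrix.of_apply,
    Matrix.vecMul, dotProduct, unrolledAdj, Finset.sum_mul, Finset.mul_sum, ite_mul, mul_ite,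
    zero_mul, mul_zero]
  calc _ = ∑ τ : Fin (k + 1), ∑ s : Fin T, ∑ i : Fin d,
        (if (s : ℕ) + τ = t then x s i * B τ i j else 0) :=
        Finset.sum_congr rfl fun τ _ => Finset.sum_comm
    _ = _ := by
        rw [Finset.sum_comm]
        exact Finset.sum_congr rfl fun s _ => Finset.sum_comm

/-- A realization of the SVAR is turned into independent Laplace shocks by the matrix
`1 - unrolledAdj T B`. -/
lemma IsLaplaceSVAR.map_vecMul {N T d k : ℕ} {Ω : Type*} [MeasurableSpace Ω] {μ : Measure Ω}
    [IsProbabilityMeasure μ] {B : Fin (k + 1) → Matrix (Fin d) (Fin d) ℝ} {b : ℝ}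
    {X S : Ω → Fin N → Fin T → Fin d → ℝ} (h : IsLaplaceSVAR μ B b X S) (n : Fin N) :
    μ.map (fun ω => Matrix.vecMul (fun p : Fin T × Fin d => X ω n p.1 p.2)
      (1 - unrolledAdj T B)) = Measure.pi fun _ => laplaceMeasure 0 b := by
  have hind : iIndepFun (fun (p : Fin T × Fin d) ω => S ω n p.1 p.2) μ :=
    h.shock_indep.precomp (g := fun p : Fin T × Fin d => (n, p)) fun p q hpq => by simpa using hpq
  have hmap := (iIndepFun_iff_map_fun_eq_pi_map
    (fun p : Fin T × Fin d => (h.shock_law n p.1 p.2).aemeasurable)).mp hind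
  simp only [fun p : Fin T × Fin d => (h.shock_law n p.1 p.2).map_eq] at hmap
  rw [← hmap]
  refine Measure.map_congr ?_
  filter_upwards [h.equation] with ω hω
  funext ⟨t, j⟩
  have hX : X ω n t j = (pastMatrix k (X ω n) * windowGraph B) t j + S ω n t j :=
    congrFun (congrFun (hω n) t) j
  rw [pastMatrix_mul_windowGraph_apply] at hX
  rw [Matrix.vecMul_sub, Matrix.vecMul_one, Pi.sub_apply]
  simp only
  linarith

/-! ### Identifiability -/

theorem theorem1 {N T d k : ℕ} (hN : 0 < N) (hd : 0 < d) (hkT : k < T)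
    {Ω : Type*} [MeasurableSpace Ω] (μ : Measure Ω) [IsProbabilityMeasure μ]
    {Ω' : Type*} [MeasurableSpace Ω'] (μ' : Measure Ω') [IsProbabilityMeasure μ']
    -- the ground truth
    (Bstar : Fin (k + 1) → Matrix (Fin d) (Fin d) ℝ) (βstar : ℝ)
    (hBstar : IsAcyclicAdj (Bstar 0)) (hβstar : 1 / ((N : ℝ) * T * d) < βstar)
    (Xstar Sstar : Ω → Fin N → Fin T → Fin d → ℝ)
    (hXstar : IsLaplaceSVAR μ Bstar βstar Xstar Sstar)
    -- any other parameters of the model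
    (B : Fin (k + 1) → Matrix (Fin d) (Fin d) ℝ) (β : ℝ)
    (hB : IsAcyclicAdj (B 0)) (hβ : 0 < β)
    (X S : Ω' → Fin N → Fin T → Fin d → ℝ)
    (hX : IsLaplaceSVAR μ' B β X S)
    -- the data have the same distribution
    (hlaw : IdentDistrib X Xstar μ' μ) :
    (∀ τ, B τ = Bstar τ) ∧ β = βstar := by
  have hβstar0 : 0 < βstar := lt_of_le_of_lt (by positivity) hβstar
  have hT : 0 < T := by omega
  have hprob : IsProbabilityMeasure (laplaceMeasure 0 β) :=
    (hX.shock_law ⟨0, hN⟩ ⟨0, hT⟩ ⟨0, hd⟩).map_eq ▸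
      Measure.isProbabilityMeasure_map (hX.shock_law _ _ _).aemeasurable
  have hprob' : IsProbabilityMeasure (laplaceMeasure 0 βstar) :=
    (hXstar.shock_law ⟨0, hN⟩ ⟨0, hT⟩ ⟨0, hd⟩).map_eq ▸
      Measure.isProbabilityMeasure_map (hXstar.shock_law _ _ _).aemeasurable
  set M := 1 - unrolledAdj T B with hM
  set M' := 1 - unrolledAdj T Bstar with hM'
  have hMu := (Matrix.isUnit_iff_isUnit_det _).mp
    (isUnit_one_sub_of_wellFounded (wellFounded_unrolledAdj (T := T) hB))
  have hMu' := (Matrix.isUnit_iff_isUnit_det _).mp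
    (isUnit_one_sub_of_wellFounded (wellFounded_unrolledAdj (T := T) hBstar))
  have hmul : ∀ R : Matrix (Fin T × Fin d) (Fin T × Fin d) ℝ,
      Measurable fun x => Matrix.vecMul x R :=
    fun R => (continuous_id.matrix_vecMul continuous_const).measurable
  have hflat : Measurable fun (x : Fin N → Fin T → Fin d → ℝ) (p : Fin T × Fin d) =>
      x ⟨0, hN⟩ p.1 p.2 := by fun_prop
  -- In law, `x ᵥ* M'` is the image of `x ᵥ* M` under `M⁻¹ * M'`.
  have hpush : (Measure.pi fun _ : Fin T × Fin d => laplaceMeasure 0 β).map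
      (fun x => Matrix.vecMul x (M⁻¹ * M')) =
      Measure.pi fun _ : Fin T × Fin d => laplaceMeasure 0 βstar := by
    have hmeas : AEMeasurable
        (fun ω => Matrix.vecMul (fun p : Fin T × Fin d => X ω ⟨0, hN⟩ p.1 p.2) M) μ' :=
      ((hmul M).comp hflat).comp_aemeasurable hlaw.aemeasurable_fst
    rw [← hX.map_vecMul ⟨0, hN⟩, ← hXstar.map_vecMul ⟨0, hN⟩,
      AEMeasurable.map_map_of_aemeasurable (hmul _).aemeasurable hmeas]
    have hMM : (fun x : Fin T × Fin d → ℝ => Matrix.vecMul x (M⁻¹ * M')) ∘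
        (fun ω => Matrix.vecMul (fun p : Fin T × Fin d => X ω ⟨0, hN⟩ p.1 p.2) M) =
        fun ω => Matrix.vecMul (fun p : Fin T × Fin d => X ω ⟨0, hN⟩ p.1 p.2) M' := by
      funext ω
      simp only [Function.comp_apply]
      rw [Matrix.vecMul_vecMul, ← mul_assoc, Matrix.mul_nonsing_inv _ hMu, one_mul]
    rw [hMM]
    exact (hlaw.comp ((hmul M').comp hflat)).map_eq
  have hLK : (M⁻¹ * M') * (M'⁻¹ * M) = 1 := by
    rw [mul_assoc, ← mul_assoc M', Matrix.mul_nonsing_inv _ hMu', one_mul,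
      Matrix.nonsing_inv_mul _ hMu]
  have hiso : ∀ y : Fin T × Fin d → ℝ,
      ∑ i, |Matrix.vecMul y (M'⁻¹ * M) i| = β / βstar * ∑ i, |y i| := fun y => by
    have := sum_abs_vecMul_eq_of_map_laplace hβ hβstar0 hLK hpush y
    field_simp at this ⊢
    linarith
  have hfac : M = M' * (M'⁻¹ * M) := by
    rw [← mul_assoc, Matrix.mul_nonsing_inv _ hMu', one_mul]
  have hK : M'⁻¹ * M = 1 :=
    eq_one_of_one_sub_eq_mul (div_pos hβ hβstar0) (wellFounded_unrolledAdj hB)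
      (fun p => by simp [hM', unrolledAdj_apply_self hBstar]) hiso hfac
  have hadj : unrolledAdj T B = unrolledAdj T Bstar := by
    rw [hK, mul_one] at hfac
    exact sub_right_injective hfac
  refine ⟨fun τ => ?_, ?_⟩
  · ext i j
    rw [← unrolledAdj_zero_left B hkT, hadj, unrolledAdj_zero_left _ hkT]
  · have := hiso (Pi.single (⟨0, hT⟩, ⟨0, hd⟩) 1)
    rw [hK, Matrix.vecMul_one] at this
    have h1 : ∑ i, |(Pi.single (⟨0, hT⟩, ⟨0, hd⟩) 1 : Fin T × Fin d → ℝ) i| = 1 := by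
      simp [Pi.single_apply, apply_ite abs]
    rw [h1, mul_one, eq_comm, div_eq_one_iff_eq hβstar0.ne'] at this
    exact this
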